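/- Let $\ell>0$ and let $\mathcal N$ be an inhomogeneous Poisson point process on $(0,\infty)$ (a random subset of $(0,\infty)$) with rate function $\mu$, where $\mu(t)>0$ for Lebesgue almost all $t\ge 0$ and $\int_0^t\mu(s)\,ds<\infty$ for every $t<\infty$. Write $M(a,b)=\int_a^b\mu(s)\,ds$. Let $T_0=0$, let $0<T_1<T_2<\cdots$ be the epochs of $\mathcal N$ (with $T_{n+1}=\infty$ if $T_n$ is the last one), and let $D=\min\{T_n<\infty:\ T_{n+1}-T_n\ge \ell\}$, with $D=\infty$ if there is no such $T_n$. Then (up to null sets) $D$ is a $[0,\infty]$-valued random variable, and for all $t\ge 0$ $$\mathbb P(D\in(t,\infty))=\int_t^\infty e^{-M(s,s+\ell)}\,\mathbb P(D>s-\ell)\,\mu(s)\,ds,$$ where the integral is finite. Consequently, the function $t\mapsto\mathbb P(D>t)$ is absolutely continuous on $[0,b]$ for every $b\ge0$, and it satisfies the delay differential equation $$\frac{d}{dt}\,\mathbb P(D>t)=-e^{-M(t,t+\ell)}\,\mathbb P(D>t-\ell)\,\mu(t)$$ for Lebesgue almost every $t\ge 0$. Moreover, the equation holds with the right derivative at every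 $t\ge0$ at which $\mu$ is right-continuous, and with the two-sided derivative at every $t>0$, $t\ne\ell$, at which $\mu$ is continuous. -/

import Mathlib

open MeasureTheory ProbabilityTheory Set Filter Topology

open scoped NNReal ENNReal

noncomputable section

/-- The Poisson law with mean `m ∈ [0, ∞]`, as a measure on `{0, 1, 2, …, ∞}`; a Poisson variable
with infinite mean is almost surely infinite. -/
def poissonLaw (m : ℝ≥0∞) : Measure ℕ∞ :=
  if m = ∞ then Measure.dirac ⊤ else (poissonMeasure m.toNNReal).map (fun k : ℕ => (k : ℕ∞))

/-- The intensity measure `M(dt) = μ(t) dt` on `(0, ∞)` with rate function `μ`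
(as a measure on `ℝ` that gives no mass to `(-∞, 0]`). -/
def intensity (μ : ℝ → ℝ) : Measure ℝ :=
  (volume.restrict (Ioi 0)).withDensity (fun t => ENNReal.ofReal (μ t))

/-- `N` is a Poisson point process on `(0, ∞)` with rate function `μ`, represented as a random
subset of `(0, ∞)`: the numbers of points in Borel sets are random variables, they are Poisson
distributed with mean given by the intensity measure, and the numbers of points in finitely many
pairwise disjoint Borel sets are independent. -/
structure IsPoissonProcess {Ω : Type*} [MeasurableSpace Ω] (N : Ω → Set ℝ) (μ : ℝ → ℝ)
    (P : Measure Ω) : Prop where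
  subset_Ioi : ∀ ω, N ω ⊆ Ioi 0
  measurable_count : ∀ A : Set ℝ, MeasurableSet A → Measurable (fun ω => (N ω ∩ A).encard)
  map_count : ∀ A : Set ℝ, MeasurableSet A →
    P.map (fun ω => (N ω ∩ A).encard) = poissonLaw (intensity μ A)
  iIndepFun_count : ∀ (n : ℕ) (A : Fin n → Set ℝ), (∀ i, MeasurableSet (A i)) →
    Pairwise (fun i j => Disjoint (A i) (A j)) →
    iIndepFun (fun i ω => (N ω ∩ A i).encard) P

/-- The epochs `T₀ = 0 < T₁ < T₂ < ⋯` of a (locally finite) set `S ⊆ (0, ∞)`: `T₀ = 0`, and `Tₙ₊₁`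
is the first point of `S` after `Tₙ`, with `Tₙ₊₁ = ∞` if there is no such point. -/
def epoch (S : Set ℝ) : ℕ → EReal
  | 0 => 0
  | n + 1 => sInf {x : EReal | x ∈ ((fun r : ℝ => (r : EReal)) '' S) ∧ epoch S n < x}

/-- `D = min {Tₙ : Tₙ₊₁ - Tₙ ≥ ℓ}`, the first epoch (`T₀ = 0` included) that is followed by a gap
of length at least `ℓ`; `D = ∞` if there is no such epoch. -/
def firstGap (ℓ : ℝ) (S : Set ℝ) : EReal :=
  sInf {x : EReal | ∃ n : ℕ, x = epoch S n ∧ epoch S n < ⊤ ∧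
    (ℓ : EReal) ≤ epoch S (n + 1) - epoch S n}

/-- `P(D > t)`, where `D` is the first epoch of `N` followed by a gap of length `ℓ`. -/
def tailProb {Ω : Type*} [MeasurableSpace Ω] (N : Ω → Set ℝ) (P : Measure Ω) (ℓ t : ℝ) : ℝ :=
  P.real {ω | (t : EReal) < firstGap ℓ (N ω)}

/-- The function `s ↦ exp (-M(s, s + ℓ)) · P(D > s - ℓ) · μ(s)`, with `M(a, b) = ∫ₐᵇ μ`. -/
def gapDensity {Ω : Type*} [MeasurableSpace Ω] (N : Ω → Set ℝ) (μ : ℝ → ℝ) (P : Measure Ω)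
    (ℓ s : ℝ) : ℝ :=
  Real.exp (-∫ x in s..(s + ℓ), μ x) * tailProb N P ℓ (s - ℓ) * μ s

end

/-! In a locally finite set, `D > u` means that every window `(x, x + ℓ)` with `0 ≤ x ≤ u` contains
a point (`lt_firstGap_iff`). This condition at `s - ℓ` depends only on the points up to `s`, so it
is independent of the points after `s`.

For `t` slightly larger than `s`, the event `s < D ≤ t` is sandwiched. It forces `D > s - ℓ`, a
point in `(s, t]` and none in `(t, s + ℓ]`. Conversely, `D > s - ℓ`, a point in `(s, t]` and none in
`(t, t + ℓ]` imply it, unless `(s - ℓ, t - ℓ]` also contains a point. That exception has probability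
at most `M(s, t) M(s - ℓ, t - ℓ) = o(M(s, t))`. Dividing by `t - s` gives the right derivative
wherever the cumulative rate has right derivative `μ(s)`
(`IsPoissonProcess.hasDerivWithinAt_tailProb`).

Increments of `P(D > ·)` on `[0, ∞)` are dominated by those of the cumulative rate, so this function
is absolutely continuous there. Being monotone, it is differentiable a.e., and the right derivative
identifies the derivative. Integrating and letting the upper limit tend to infinity gives the
formula for `P(D ∈ (t, ∞))`. -/

/-! ### Deterministic facts on epochs and gaps. -/

/-- No interval `(x, x + ℓ)` with `0 ≤ x ≤ u` is free of points of `S`. -/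
def NoGap (ℓ : ℝ) (S : Set ℝ) (u : ℝ) : Prop :=
  ∀ x, 0 ≤ x → x ≤ u → (S ∩ Ioo x (x + ℓ)).Nonempty

theorem NoGap.mono {ℓ : ℝ} {S : Set ℝ} {u v : ℝ} (h : NoGap ℓ S v) (huv : u ≤ v) :
    NoGap ℓ S u :=
  fun x hx hxu => h x hx (hxu.trans huv)

theorem noGap_of_neg {ℓ : ℝ} {S : Set ℝ} {u : ℝ} (hu : u < 0) : NoGap ℓ S u :=
  fun _ hx hxu => absurd (hx.trans hxu) (not_le.2 hu)

theorem epoch_le_epoch_succ (S : Set ℝ) (n : ℕ) : epoch S n ≤ epoch S (n + 1) :=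
  le_sInf fun _ hx => hx.2.le

theorem epoch_nonneg (S : Set ℝ) (n : ℕ) : 0 ≤ epoch S n := by
  induction n with
  | zero => exact le_rfl
  | succ n ih => exact ih.trans (epoch_le_epoch_succ S n)

theorem epoch_succ_le {S : Set ℝ} {n : ℕ} {y : ℝ} (hy : y ∈ S) (h : epoch S n < y) :
    epoch S (n + 1) ≤ y :=
  sInf_le ⟨mem_image_of_mem _ hy, h⟩

theorem epoch_mono (S : Set ℝ) : Monotone (epoch S) :=
  monotone_nat_of_le_succ (epoch_le_epoch_succ S)

/-- In a locally finite set, a finite epoch is attained. -/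
theorem exists_eq_epoch_succ {S : Set ℝ} (hfin : ∀ t : ℝ, (S ∩ Iic t).Finite) {n : ℕ} {t : ℝ}
    (h : epoch S (n + 1) ≤ t) : ∃ y ∈ S, epoch S (n + 1) = (y : EReal) ∧ epoch S n < y := by
  -- The cutoff is `t + 1`, not `t`: the infimum is not yet known to be attained, but being below `t
  -- + 1` it has a competitor there.
  set A : Set ℝ := {y | y ∈ S ∩ Iic (t + 1) ∧ epoch S n < y} with hA
  have hAfin : A.Finite := (hfin (t + 1)).subset fun y hy => hy.1
  have hlt : epoch S (n + 1) < ((t + 1 : ℝ) : EReal) :=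
    h.trans_lt (by exact_mod_cast lt_add_one t)
  have hne : A.Nonempty := by
    obtain ⟨x, ⟨⟨y, hyS, rfl⟩, hy⟩, hyt⟩ := sInf_lt_iff.1 hlt
    exact ⟨y, ⟨hyS, EReal.coe_le_coe_iff.1 hyt.le⟩, hy⟩
  obtain ⟨y, hyA, hmin⟩ := hAfin.exists_minimal hne
  refine ⟨y, hyA.1.1, le_antisymm (epoch_succ_le hyA.1.1 hyA.2) ?_, hyA.2⟩
  refine le_sInf ?_
  rintro _ ⟨⟨z, hzS, rfl⟩, hz⟩
  by_contra hzy
  have hzy' : z < y := EReal.coe_lt_coe_iff.1 (not_le.1 hzy)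
  have hyt : y ≤ t + 1 := hyA.1.2
  exact absurd (hmin ⟨⟨hzS, hzy'.le.trans hyt⟩, hz⟩ hzy'.le) (not_le.2 hzy')

/-- In a locally finite set, the epochs leave every bounded interval. -/
theorem exists_lt_epoch {S : Set ℝ} (hfin : ∀ t : ℝ, (S ∩ Iic t).Finite) (t : ℝ) :
    ∃ n, (t : EReal) < epoch S n := by
  by_contra! hcon
  choose y hyS hy hlt using fun n => exists_eq_epoch_succ hfin (hcon (n + 1))
  have hmono : StrictMono y := strictMono_nat_of_lt_succ fun n => by
    have := hlt (n + 1)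
    rw [hy n] at this
    exact_mod_cast this
  refine Set.infinite_range_of_injective hmono.injective ((hfin t).subset ?_)
  rintro _ ⟨n, rfl⟩
  have := hcon (n + 1)
  rw [hy n] at this
  exact ⟨hyS n, by exact_mod_cast this⟩

/-- An empty window starting at `x` extends back to the last epoch before or at `x`, so windows may
start anywhere and epochs need not be mentioned. -/
theorem lt_firstGap_iff {ℓ : ℝ} {S : Set ℝ}
    (hfin : ∀ t : ℝ, (S ∩ Iic t).Finite) (u : ℝ) :
    (u : EReal) < firstGap ℓ S ↔ NoGap ℓ S u := by
  constructor
  · intro h x hx hxu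
    by_contra hgap
    have hex : ∃ n, (x : EReal) < epoch S n := exists_lt_epoch hfin x
    classical
    obtain ⟨n, hn, hn'⟩ : ∃ n, epoch S n ≤ x ∧ (x : EReal) < epoch S (n + 1) := by
      have h0 : Nat.find hex ≠ 0 := by
        intro h0
        have := Nat.find_spec hex
        rw [h0] at this
        exact absurd this (not_lt.2 (by simpa [epoch] using hx))
      obtain ⟨k, hk⟩ := Nat.exists_eq_succ_of_ne_zero h0
      refine ⟨k, not_lt.1 (Nat.find_min hex (by omega)), ?_⟩
      have := Nat.find_spec hex
      rwa [hk] at this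
    have hle : ((x + ℓ : ℝ) : EReal) ≤ epoch S (n + 1) := by
      refine le_sInf ?_
      rintro _ ⟨⟨y, hyS, rfl⟩, hy⟩
      have hxy : x < y := by exact_mod_cast hn'.trans_le (epoch_succ_le hyS hy)
      by_contra hlt
      exact hgap ⟨y, hyS, hxy, EReal.coe_lt_coe_iff.1 (not_le.1 hlt)⟩
    have hmem : firstGap ℓ S ≤ epoch S n := by
      refine sInf_le ⟨n, rfl, hn.trans_lt (EReal.coe_lt_top x), ?_⟩
      calc (ℓ : EReal) = ((x + ℓ : ℝ) : EReal) - (x : EReal) := by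
            rw [← EReal.coe_sub]; congr 1; ring
        _ ≤ epoch S (n + 1) - epoch S n := EReal.sub_le_sub hle hn
    have : (u : EReal) < x := h.trans_le (hmem.trans hn)
    exact absurd hxu (not_le.2 (by exact_mod_cast this))
  · intro h
    have key : ∀ n, epoch S n < ⊤ → (ℓ : EReal) ≤ epoch S (n + 1) - epoch S n →
        (u : EReal) < epoch S n := by
      intro n htop hgap
      obtain ⟨x, hx⟩ : ∃ x : ℝ, epoch S n = x :=
        ⟨(epoch S n).toReal, (EReal.coe_toReal htop.ne
          (ne_of_gt ((EReal.bot_lt_zero).trans_le (epoch_nonneg S n)))).symm⟩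
      have hx0 : 0 ≤ x := by
        have := epoch_nonneg S n
        rw [hx] at this
        exact_mod_cast this
      rw [hx]
      by_contra hxu
      obtain ⟨y, hyS, hy⟩ := h x hx0 (by exact_mod_cast not_lt.1 hxu)
      have hle : epoch S (n + 1) ≤ y :=
        epoch_succ_le hyS (by rw [hx]; exact_mod_cast hy.1)
      have h2 : (ℓ : EReal) ≤ (y : EReal) - (x : EReal) :=
        hgap.trans (EReal.sub_le_sub hle hx.ge)
      rw [← EReal.coe_sub] at h2
      have h3 : ℓ ≤ y - x := by exact_mod_cast h2
      linarith [hy.2]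
    rcases Set.eq_empty_or_nonempty {x : EReal | ∃ n : ℕ, x = epoch S n ∧ epoch S n < ⊤ ∧
      (ℓ : EReal) ≤ epoch S (n + 1) - epoch S n} with he | ⟨_, n, -, hn⟩
    · rw [firstGap, he, sInf_empty]
      exact EReal.coe_lt_top u
    -- The strict bound must survive the infimum; it does because the least admissible index attains
    -- it.
    · classical
      have hex : ∃ n, epoch S n < ⊤ ∧ (ℓ : EReal) ≤ epoch S (n + 1) - epoch S n := ⟨n, hn⟩
      refine (key _ (Nat.find_spec hex).1 (Nat.find_spec hex).2).trans_le (le_sInf ?_)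
      rintro _ ⟨k, rfl, hk⟩
      exact epoch_mono S (Nat.find_min' hex hk)

/-- A first gap that starts in `(s, t]` forces points in `(s, t]` and none in `(t, s + ℓ]`. -/
theorem NoGap.of_not_noGap {ℓ : ℝ} {S : Set ℝ} {s t : ℝ} (hℓ : 0 < ℓ) (hs : 0 ≤ s)
    (hG : NoGap ℓ S s) (hnG : ¬ NoGap ℓ S t) :
    NoGap ℓ S (s - ℓ) ∧ (S ∩ Ioc s t).Nonempty ∧ S ∩ Ioc t (s + ℓ) = ∅ := by
  refine ⟨hG.mono (by linarith), ?_⟩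
  simp only [NoGap, not_forall] at hnG
  obtain ⟨x, hx, hxt, hgap⟩ := hnG
  have hsx : s < x := by
    by_contra hxs
    exact hgap (hG x hx (not_lt.1 hxs))
  constructor
  · obtain ⟨y, hyS, hy⟩ := hG s hs le_rfl
    refine ⟨y, hyS, hy.1, ?_⟩
    by_contra hyt
    exact hgap ⟨y, hyS, hxt.trans_lt (not_le.1 hyt), by linarith [hy.2]⟩
  · rw [Set.eq_empty_iff_forall_notMem]
    rintro y ⟨hyS, hy⟩
    exact hgap ⟨y, hyS, hxt.trans_lt hy.1, by linarith [hy.2]⟩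

/-- Points in `(s, t]` and none in `(t, t + ℓ]` force a first gap in `(s, t]`, unless there is one
that starts shortly after `s - ℓ`. -/
theorem NoGap.of_nonempty_of_eq_empty {ℓ : ℝ} {S : Set ℝ} {s t : ℝ} (hs : 0 ≤ s)
    (hst : s < t) (h : t < ℓ ∨ ℓ ≤ s)
    (hG : NoGap ℓ S (s - ℓ)) (hne : (S ∩ Ioc s t).Nonempty) (he : S ∩ Ioc t (t + ℓ) = ∅) :
    (NoGap ℓ S s ∧ ¬ NoGap ℓ S t) ∨ (S ∩ Ioc (s - ℓ) (t - ℓ)).Nonempty := by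
  have hnG : ¬ NoGap ℓ S t := by
    intro hGt
    obtain ⟨y, hyS, hy⟩ := hGt t (hs.trans hst.le) le_rfl
    exact (Set.eq_empty_iff_forall_notMem.1 he) y ⟨hyS, hy.1, hy.2.le⟩
  by_cases hGs : NoGap ℓ S s
  · exact Or.inl ⟨hGs, hnG⟩
  right
  simp only [NoGap, not_forall] at hGs
  obtain ⟨x, hx, hxs, hgap⟩ := hGs
  have hsx : s - ℓ < x := by
    by_contra hxs'
    exact hgap (hG x hx (not_lt.1 hxs'))
  obtain ⟨y, hyS, hy⟩ := hne
  have hyx : x + ℓ ≤ y := by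
    by_contra hyx
    exact hgap ⟨y, hyS, hxs.trans_lt hy.1, not_le.1 hyx⟩
  have hxt : x ≤ t - ℓ := by linarith [hy.2]
  -- The window at `x` has `x ≤ t - ℓ`. If `t < ℓ`, this contradicts `0 ≤ x`. Otherwise the window
  -- at `s - ℓ` contains a point, which must lie at or before `x`.
  rcases h with h | h
  · linarith
  obtain ⟨z, hzS, hz⟩ := hG (s - ℓ) (by linarith) le_rfl
  refine ⟨z, hzS, hz.1, le_trans ?_ hxt⟩
  by_contra hzx
  exact hgap ⟨z, hzS, not_le.1 hzx, by linarith [hz.2]⟩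

/-- A gap that starts in `[0, u]` is detected by slightly shorter empty intervals with rational
endpoints. -/
theorem not_noGap_iff {ℓ : ℝ} {S : Set ℝ} {u : ℝ} :
    ¬ NoGap ℓ S u ↔ ∀ n : ℕ, ∃ q : ℚ, (-(1 / ((n : ℝ) + 1)) ≤ q ∧ (q : ℝ) ≤ u + 1 / ((n : ℝ) + 1)) ∧
      S ∩ Ioo ((q : ℝ) + 1 / ((n : ℝ) + 1)) (q + ℓ - 1 / ((n : ℝ) + 1)) = ∅ := by
  constructor
  · intro h n
    simp only [NoGap, not_forall] at h
    obtain ⟨x, hx, hxu, hgap⟩ := h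
    have hn : 0 < 1 / ((n : ℝ) + 1) := by positivity
    obtain ⟨q, hq1, hq2⟩ := exists_rat_btwn (lt_add_of_pos_right x hn)
    refine ⟨q, ⟨by linarith, by linarith⟩, ?_⟩
    rw [Set.eq_empty_iff_forall_notMem]
    rintro y ⟨hyS, hy⟩
    exact hgap ⟨y, hyS, by linarith [hy.1], by linarith [hy.2]⟩
  · intro h hG
    choose q hq hgap using h
    have hlim : Tendsto (fun n : ℕ => 1 / ((n : ℝ) + 1)) atTop (𝓝 0) :=
      tendsto_one_div_add_atTop_nhds_zero_nat
    have hle1 : ∀ n : ℕ, 1 / ((n : ℝ) + 1) ≤ 1 := fun n => by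
      rw [div_le_one (by positivity)]
      linarith [n.cast_nonneg (α := ℝ)]
    -- Compactness gives a limit `x` of the starting points; a point of the open window at `x` would
    -- eventually lie in the shortened windows.
    obtain ⟨x, -, φ, hφ, hx⟩ := (isCompact_Icc (a := (-1 : ℝ)) (b := u + 1)).tendsto_subseq
      (x := fun n => (q n : ℝ)) fun n =>
        ⟨by linarith [(hq n).1, hle1 n], by linarith [(hq n).2, hle1 n]⟩
    have hlim' := hlim.comp hφ.tendsto_atTop
    have hx0 : 0 ≤ x := by
      refine le_of_tendsto_of_tendsto' (by simpa using hlim'.neg) hx fun n => ?_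
      simpa using (hq (φ n)).1
    have hxu : x ≤ u := by
      refine le_of_tendsto_of_tendsto' hx (by simpa using hlim'.const_add u) fun n => ?_
      simpa using (hq (φ n)).2
    obtain ⟨y, hyS, hy⟩ := hG x hx0 hxu
    have h1 : ∀ᶠ n in atTop, (q (φ n) : ℝ) + 1 / ((φ n : ℝ) + 1) < y :=
      (by simpa using hx.add hlim' : Tendsto _ _ (𝓝 x)).eventually_lt_const hy.1
    have h2 : ∀ᶠ n in atTop, y < (q (φ n) : ℝ) + ℓ - 1 / ((φ n : ℝ) + 1) :=
      (by simpa using (hx.add_const ℓ).sub hlim' :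
        Tendsto _ _ (𝓝 (x + ℓ))).eventually_const_lt hy.2
    obtain ⟨n, hn1, hn2⟩ := (h1.and h2).exists
    exact (Set.eq_empty_iff_forall_notMem.1 (hgap (φ n))) y ⟨hyS, hn1, hn2⟩

/-! ### Void events, measurability and independence. -/

theorem poissonLaw_singleton_zero {m : ℝ≥0∞} (hm : m ≠ ∞) :
    poissonLaw m {0} = ENNReal.ofReal (Real.exp (-m.toReal)) := by
  rw [poissonLaw, if_neg hm, Measure.map_apply .of_discrete (measurableSet_singleton _)]
  have : (fun k : ℕ => (k : ℕ∞)) ⁻¹' {0} = {0} := by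
    ext k
    simp
  rw [this, poissonMeasure_singleton]
  simp [ENNReal.coe_toNNReal_eq_toReal]

theorem poissonLaw_singleton_top {m : ℝ≥0∞} (hm : m ≠ ∞) : poissonLaw m {⊤} = 0 := by
  rw [poissonLaw, if_neg hm, Measure.map_apply .of_discrete (measurableSet_singleton _)]
  have : (fun k : ℕ => (k : ℕ∞)) ⁻¹' {⊤} = ∅ := by
    ext k
    simp
  rw [this, measure_empty]

/-- The event that a random set `N` has no point in `A`. -/
def voidEvent {Ω : Type*} (N : Ω → Set ℝ) (A : Set ℝ) : Set Ω :=
  {ω | N ω ∩ A = ∅}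

theorem voidEvent_eq_preimage {Ω : Type*} (N : Ω → Set ℝ) (A : Set ℝ) :
    voidEvent N A = (fun ω => (N ω ∩ A).encard) ⁻¹' {0} := by
  ext ω
  simp [voidEvent]

/-- The void events of the Borel subsets of `B`. -/
def voidEvents {Ω : Type*} (N : Ω → Set ℝ) (B : Set ℝ) : Set (Set Ω) :=
  {E | ∃ A, MeasurableSet A ∧ A ⊆ B ∧ E = voidEvent N A}

theorem isPiSystem_voidEvents {Ω : Type*} (N : Ω → Set ℝ) (B : Set ℝ) :
    IsPiSystem (voidEvents N B) := by
  rintro _ ⟨A, hA, hAB, rfl⟩ _ ⟨A', hA', hAB', rfl⟩ -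
  refine ⟨A ∪ A', hA.union hA', union_subset hAB hAB', ?_⟩
  ext ω
  simp [voidEvent, inter_union_distrib_left]

/-- Naming the σ-algebra, rather than only proving measurability, records that the event depends
only on points up to `u + ℓ`; independence rests on this. -/
theorem measurableSet_generateFrom_noGap {Ω : Type*} (N : Ω → Set ℝ) (ℓ u : ℝ) :
    MeasurableSet[MeasurableSpace.generateFrom (voidEvents N (Iic (u + ℓ)))]
      {ω | NoGap ℓ (N ω) u} := by
  have heq : {ω | NoGap ℓ (N ω) u}ᶜ = ⋂ n : ℕ, ⋃ q : ℚ,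
      ⋃ _ : -(1 / ((n : ℝ) + 1)) ≤ q ∧ (q : ℝ) ≤ u + 1 / ((n : ℝ) + 1),
      voidEvent N (Ioo ((q : ℝ) + 1 / ((n : ℝ) + 1)) (q + ℓ - 1 / ((n : ℝ) + 1))) := by
    ext ω
    have := @not_noGap_iff ℓ (N ω) u
    simpa only [mem_compl_iff, mem_ofPred_eq, mem_iInter, mem_iUnion, exists_prop, voidEvent]
      using this
  refine MeasurableSet.of_compl ?_
  rw [heq]
  refine MeasurableSet.iInter fun n => MeasurableSet.iUnion fun q => MeasurableSet.iUnion fun hq =>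
    MeasurableSpace.measurableSet_generateFrom ⟨_, measurableSet_Ioo, fun y hy => ?_, rfl⟩
  have h1 := hy.2
  have h2 := hq.2
  simp only [mem_Iic]
  linarith

section Poisson

variable {Ω : Type*} [MeasurableSpace Ω] {P : Measure Ω} {μ : ℝ → ℝ} {N : Ω → Set ℝ}

theorem IsPoissonProcess.measurableSet_voidEvent (hN : IsPoissonProcess N μ P) {A : Set ℝ}
    (hA : MeasurableSet A) : MeasurableSet (voidEvent N A) := by
  rw [voidEvent_eq_preimage]
  exact hN.measurable_count A hA (measurableSet_singleton _)

theorem IsPoissonProcess.measurableSet_noGap (hN : IsPoissonProcess N μ P) (ℓ u : ℝ) :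
    MeasurableSet {ω | NoGap ℓ (N ω) u} := by
  refine MeasurableSpace.generateFrom_le ?_ _ (measurableSet_generateFrom_noGap N ℓ u)
  rintro _ ⟨A, hA, -, rfl⟩
  exact hN.measurableSet_voidEvent hA

theorem IsPoissonProcess.measureReal_voidEvent (hN : IsPoissonProcess N μ P) {A : Set ℝ}
    (hA : MeasurableSet A) (hfin : intensity μ A ≠ ∞) :
    P.real (voidEvent N A) = Real.exp (-(intensity μ A).toReal) := by
  rw [voidEvent_eq_preimage, measureReal_def,
    ← Measure.map_apply (hN.measurable_count A hA) (measurableSet_singleton _), hN.map_count A hA,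
    poissonLaw_singleton_zero hfin, ENNReal.toReal_ofReal (Real.exp_pos _).le]

theorem IsPoissonProcess.ae_finite (hN : IsPoissonProcess N μ P)
    (hfin : ∀ t : ℝ, intensity μ (Iic t) ≠ ∞) : ∀ᵐ ω ∂P, ∀ t : ℝ, (N ω ∩ Iic t).Finite := by
  have h : ∀ n : ℕ, ∀ᵐ ω ∂P, (N ω ∩ Iic (n : ℝ)).Finite := by
    intro n
    have h0 := poissonLaw_singleton_top (hfin n)
    rw [← hN.map_count _ measurableSet_Iic,
      Measure.map_apply (hN.measurable_count _ measurableSet_Iic) (measurableSet_singleton _)] at h0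
    filter_upwards [measure_eq_zero_iff_ae_notMem.1 h0] with ω hω
    simpa [Set.encard_eq_top_iff, Set.not_infinite] using hω
  filter_upwards [ae_all_iff.2 h] with ω hω t
  obtain ⟨n, hn⟩ := exists_nat_ge t
  exact (hω n).subset (inter_subset_inter_right _ (Iic_subset_Iic.2 hn))

theorem IsPoissonProcess.measure_void_inter_inter (hN : IsPoissonProcess N μ P)
    [IsProbabilityMeasure P] {A B C : Set ℝ} (hA : MeasurableSet A) (hB : MeasurableSet B)
    (hC : MeasurableSet C) (hAB : Disjoint A B) (hAC : Disjoint A C) (hBC : Disjoint B C)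
    (K L : Set ℕ∞) :
    P (voidEvent N A ∩ ({ω | (N ω ∩ B).encard ∈ K} ∩ {ω | (N ω ∩ C).encard ∈ L})) =
      P (voidEvent N A) * (P {ω | (N ω ∩ B).encard ∈ K} * P {ω | (N ω ∩ C).encard ∈ L}) := by
  have hind := hN.iIndepFun_count 3 ![A, B, C]
    (by intro i; fin_cases i <;> simpa)
    (by
      intro i j hij
      fin_cases i <;> fin_cases j <;>
        simp_all [hAB.symm, hAC.symm, hBC.symm])
  have := hind.measure_inter_preimage_eq_mul Finset.univ (sets := ![{0}, K, L])
    (fun i _ => .of_discrete)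
  simp only [Fin.prod_univ_three, Finset.mem_univ, iInter_true] at this
  rw [voidEvent_eq_preimage, ← mul_assoc]
  refine Eq.trans (congrArg P ?_) this
  ext ω
  simp [Fin.forall_fin_succ]

/-- Void events of Borel subsets of `(-∞, s]` form a π-system, so independence of counts on disjoint
sets extends to the σ-algebra containing the no-gap event. -/
theorem IsPoissonProcess.measureReal_noGap_inter (hN : IsPoissonProcess N μ P)
    [IsProbabilityMeasure P] (ℓ : ℝ) {s : ℝ} {B C : Set ℝ} (hB : MeasurableSet B)
    (hC : MeasurableSet C) (hBs : B ⊆ Ioi s) (hCs : C ⊆ Ioi s) (hBC : Disjoint B C) :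
    P.real ({ω | NoGap ℓ (N ω) (s - ℓ)} ∩ ({ω | (N ω ∩ B).Nonempty} ∩ voidEvent N C)) =
      P.real {ω | NoGap ℓ (N ω) (s - ℓ)} *
        ((1 - P.real (voidEvent N B)) * P.real (voidEvent N C)) := by
  have hBeq : {ω | (N ω ∩ B).Nonempty} = {ω | (N ω ∩ B).encard ∈ ({0}ᶜ : Set ℕ∞)} := by
    ext ω
    simp [Set.nonempty_iff_ne_empty]
  have hBcompl : {ω | (N ω ∩ B).Nonempty} = (voidEvent N B)ᶜ := by
    ext ω
    simp [Set.nonempty_iff_ne_empty, voidEvent]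
  have hCeq : voidEvent N C = {ω | (N ω ∩ C).encard ∈ ({0} : Set ℕ∞)} := voidEvent_eq_preimage N C
  set E : Set Ω := {ω | (N ω ∩ B).Nonempty} ∩ voidEvent N C with hE
  have hdisj : ∀ {A D : Set ℝ}, A ⊆ Iic s → D ⊆ Ioi s → Disjoint A D := fun h1 h2 =>
    (Iic_disjoint_Ioi le_rfl).mono h1 h2
  have hmE : MeasurableSet E := by
    rw [hE, hBcompl]
    exact (hN.measurableSet_voidEvent hB).compl.inter (hN.measurableSet_voidEvent hC)
  have hprod : P E = P {ω | (N ω ∩ B).Nonempty} * P (voidEvent N C) := by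
    -- With the first set empty, the three-set identity reduces to two sets.
    have := hN.measure_void_inter_inter MeasurableSet.empty hB hC (empty_disjoint _)
      (empty_disjoint _) hBC {0}ᶜ {0}
    rw [← hBeq, ← hCeq] at this
    simpa [hE, voidEvent] using this
  have hind : Indep (MeasurableSpace.generateFrom (voidEvents N (Iic s)))
      (MeasurableSpace.generateFrom {E}) P := by
    refine IndepSets.indep' ?_ ?_ (isPiSystem_voidEvents N _) (IsPiSystem.singleton _) ?_
    · rintro _ ⟨A, hA, -, rfl⟩
      exact hN.measurableSet_voidEvent hA
    · rintro _ rfl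
      exact hmE
    · rw [IndepSets_iff]
      rintro _ _ ⟨A, hA, hAs, rfl⟩ rfl
      rw [hprod, hE, hBeq, hCeq]
      exact hN.measure_void_inter_inter hA hB hC (hdisj hAs hBs) (hdisj hAs hCs) hBC _ _
  have hmeas := measurableSet_generateFrom_noGap N ℓ (s - ℓ)
  rw [sub_add_cancel] at hmeas
  have := (Indep_iff _ _ P).1 hind _ E hmeas (MeasurableSpace.measurableSet_generateFrom rfl)
  rw [measureReal_def, this, hprod, ENNReal.toReal_mul, ENNReal.toReal_mul, hBcompl,
    ← measureReal_def P (voidEvent N B)ᶜ, probReal_compl_eq_one_sub (hN.measurableSet_voidEvent hB)]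
  rfl

end Poisson

/-! ### The cumulative rate; the cutoff at `0` lets intervals such as `(s - ℓ, t - ℓ]` reach below
zero. -/

section Rate

/-- The rate function `μ`, cut off at negative times. -/
noncomputable def cutRate (μ : ℝ → ℝ) : ℝ → ℝ := (Ici (0 : ℝ)).indicator μ

/-- The cumulative rate `M(0, t)`, which vanishes for `t ≤ 0`. -/
noncomputable def cumRate (μ : ℝ → ℝ) (t : ℝ) : ℝ := ∫ x in (0 : ℝ)..t, cutRate μ x

variable {μ : ℝ → ℝ}

theorem cutRate_of_nonneg {t : ℝ} (ht : 0 ≤ t) : cutRate μ t = μ t :=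
  indicator_of_mem (mem_Ici.2 ht) μ

theorem intervalIntegrable_cutRate (hμ : ∀ t : ℝ, IntegrableOn μ (Ioc 0 t)) (a b : ℝ) :
    IntervalIntegrable (cutRate μ) volume a b := by
  rw [intervalIntegrable_iff, cutRate, IntegrableOn, integrable_indicator_iff measurableSet_Ici,
    IntegrableOn, Measure.restrict_restrict measurableSet_Ici]
  refine IntegrableOn.mono_set ((integrableOn_Icc_iff_integrableOn_Ioc).2 (hμ (max a b))) ?_
  exact fun x hx => ⟨hx.1, hx.2.2⟩

theorem cutRate_nonneg_ae (hpos : ∀ᵐ t ∂(volume.restrict (Ioi (0 : ℝ))), 0 < μ t) :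
    ∀ᵐ t, 0 ≤ cutRate μ t := by
  have h0 : ∀ᵐ t : ℝ, t ≠ 0 := by simp [ae_iff]
  filter_upwards [(ae_restrict_iff' measurableSet_Ioi).1 hpos, h0] with t ht ht0
  by_cases h : 0 ≤ t
  · rw [cutRate_of_nonneg h]
    exact (ht (lt_of_le_of_ne h ht0.symm)).le
  · rw [cutRate, indicator_of_notMem (by simpa using h)]

theorem cumRate_sub_cumRate (hμ : ∀ t : ℝ, IntegrableOn μ (Ioc 0 t)) (a b : ℝ) :
    cumRate μ b - cumRate μ a = ∫ x in a..b, cutRate μ x :=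
  intervalIntegral.integral_interval_sub_left (intervalIntegrable_cutRate hμ _ _)
    (intervalIntegrable_cutRate hμ _ _)

theorem cumRate_sub_cumRate_of_nonneg (hμ : ∀ t : ℝ, IntegrableOn μ (Ioc 0 t)) {a b : ℝ}
    (ha : 0 ≤ a) (hab : a ≤ b) : cumRate μ b - cumRate μ a = ∫ x in a..b, μ x := by
  rw [cumRate_sub_cumRate hμ]
  refine intervalIntegral.integral_congr fun x hx => ?_
  rw [uIcc_of_le hab] at hx
  exact cutRate_of_nonneg (ha.trans hx.1)

theorem continuous_cumRate (hμ : ∀ t : ℝ, IntegrableOn μ (Ioc 0 t)) : Continuous (cumRate μ) :=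
  intervalIntegral.continuous_primitive (intervalIntegrable_cutRate hμ) 0

theorem monotone_cumRate (hμ : ∀ t : ℝ, IntegrableOn μ (Ioc 0 t))
    (hpos : ∀ᵐ t ∂(volume.restrict (Ioi (0 : ℝ))), 0 < μ t) : Monotone (cumRate μ) := by
  intro a b hab
  rw [← sub_nonneg, cumRate_sub_cumRate hμ]
  exact intervalIntegral.integral_nonneg_of_ae hab (cutRate_nonneg_ae hpos)

theorem ae_hasDerivAt_cumRate (hμ : ∀ t : ℝ, IntegrableOn μ (Ioc 0 t)) :
    ∀ᵐ t, HasDerivAt (cumRate μ) (cutRate μ t) t := by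
  have hloc : LocallyIntegrable (cutRate μ) := fun x =>
    ⟨Ioc (x - 1) (x + 1), Ioc_mem_nhds (by linarith) (by linarith),
      (intervalIntegrable_iff_integrableOn_Ioc_of_le (by linarith)).1
        (intervalIntegrable_cutRate hμ _ _)⟩
  filter_upwards [LocallyIntegrable.ae_hasDerivAt_integral hloc] with t ht
  exact ht 0

theorem hasDerivWithinAt_cumRate (hμ : ∀ t : ℝ, IntegrableOn μ (Ioc 0 t)) {t : ℝ} (ht : 0 ≤ t)
    (hc : ContinuousWithinAt μ (Ici t) t) : HasDerivWithinAt (cumRate μ) (μ t) (Ici t) t := by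
  rw [← cutRate_of_nonneg (μ := μ) ht]
  refine intervalIntegral.integral_hasDerivWithinAt_right (t := Ioi t)
    (intervalIntegrable_cutRate hμ _ _) ?_ ?_
  · exact ⟨Ioc t (t + 1), Ioc_mem_nhdsGT (by linarith),
      ((intervalIntegrable_iff_integrableOn_Ioc_of_le (by linarith)).1
        (intervalIntegrable_cutRate hμ _ _)).aestronglyMeasurable⟩
  · refine (hc.mono Ioi_subset_Ici_self).congr (fun x hx => ?_) (cutRate_of_nonneg ht)
    exact cutRate_of_nonneg (ht.trans (le_of_lt hx))

theorem intensity_Ioc (hμ : ∀ t : ℝ, IntegrableOn μ (Ioc 0 t))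
    (hpos : ∀ᵐ t ∂(volume.restrict (Ioi (0 : ℝ))), 0 < μ t) {a b : ℝ} (hab : a ≤ b) :
    intensity μ (Ioc a b) = ENNReal.ofReal (cumRate μ b - cumRate μ a) := by
  have h1 : intensity μ = volume.withDensity fun t => ENNReal.ofReal (cutRate μ t) := by
    rw [intensity, Measure.restrict_congr_set Ioi_ae_eq_Ici, ← withDensity_indicator measurableSet_Ici]
    congr 1
    ext t
    by_cases h : t ∈ Ici (0 : ℝ) <;> simp [cutRate, h]
  rw [h1, withDensity_apply _ measurableSet_Ioc, cumRate_sub_cumRate hμ,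
    intervalIntegral.integral_of_le hab, ofReal_integral_eq_lintegral_ofReal]
  · exact (intervalIntegrable_iff_integrableOn_Ioc_of_le hab).1 (intervalIntegrable_cutRate hμ _ _)
  · exact ae_restrict_of_ae (cutRate_nonneg_ae hpos)

theorem intensity_Iic_ne_top (hμ : ∀ t : ℝ, IntegrableOn μ (Ioc 0 t))
    (hpos : ∀ᵐ t ∂(volume.restrict (Ioi (0 : ℝ))), 0 < μ t) (t : ℝ) :
    intensity μ (Iic t) ≠ ∞ := by
  have h0 : intensity μ (Iic 0) = 0 := by
    rw [intensity, withDensity_apply _ measurableSet_Iic,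
      Measure.restrict_restrict measurableSet_Iic,
      (Iic_disjoint_Ioi (le_refl (0 : ℝ))).inter_eq, Measure.restrict_empty, lintegral_zero_measure]
  refine ((measure_mono (Iic_subset_Iic.2 (le_max_right 0 t))).trans_lt ?_).ne
  rw [← Iic_union_Ioc_eq_Iic (le_max_left 0 t)]
  refine (measure_union_le _ _).trans_lt ?_
  rw [h0, zero_add, intensity_Ioc hμ hpos (le_max_left 0 t)]
  exact ENNReal.ofReal_lt_top

end Rate

/-! ### Two-sided bounds on the increments of `P(D > ·)`. -/

section Increments

variable {Ω : Type*} [MeasurableSpace Ω] {P : Measure Ω} {μ : ℝ → ℝ} {N : Ω → Set ℝ}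

theorem IsPoissonProcess.ae_lt_firstGap_iff (hN : IsPoissonProcess N μ P)
    (hμ : ∀ t : ℝ, IntegrableOn μ (Ioc 0 t))
    (hpos : ∀ᵐ t ∂(volume.restrict (Ioi (0 : ℝ))), 0 < μ t) (ℓ : ℝ) :
    ∀ᵐ ω ∂P, ∀ u : ℝ, (u : EReal) < firstGap ℓ (N ω) ↔ NoGap ℓ (N ω) u := by
  filter_upwards [hN.ae_finite (intensity_Iic_ne_top hμ hpos)] with ω hω
  exact lt_firstGap_iff hω

theorem IsPoissonProcess.tailProb_eq (hN : IsPoissonProcess N μ P)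
    (hμ : ∀ t : ℝ, IntegrableOn μ (Ioc 0 t))
    (hpos : ∀ᵐ t ∂(volume.restrict (Ioi (0 : ℝ))), 0 < μ t) (ℓ u : ℝ) :
    tailProb N P ℓ u = P.real {ω | NoGap ℓ (N ω) u} := by
  refine measureReal_congr ?_
  filter_upwards [hN.ae_lt_firstGap_iff hμ hpos ℓ] with ω hω
  exact propext (hω u)

theorem IsPoissonProcess.tailProb_of_neg [IsProbabilityMeasure P] (hN : IsPoissonProcess N μ P)
    (hμ : ∀ t : ℝ, IntegrableOn μ (Ioc 0 t))
    (hpos : ∀ᵐ t ∂(volume.restrict (Ioi (0 : ℝ))), 0 < μ t) (ℓ : ℝ) {u : ℝ} (hu : u < 0) :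
    tailProb N P ℓ u = 1 := by
  rw [hN.tailProb_eq hμ hpos]
  simp [noGap_of_neg hu]

theorem tailProb_nonneg (N : Ω → Set ℝ) (P : Measure Ω) (ℓ u : ℝ) : 0 ≤ tailProb N P ℓ u :=
  measureReal_nonneg

theorem tailProb_le_one [IsProbabilityMeasure P] (N : Ω → Set ℝ) (ℓ u : ℝ) :
    tailProb N P ℓ u ≤ 1 :=
  measureReal_le_one

theorem antitone_tailProb [IsProbabilityMeasure P] (N : Ω → Set ℝ) (ℓ : ℝ) :
    Antitone (tailProb N P ℓ) := fun _ _ huv =>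
  measureReal_mono fun _ hω => (EReal.coe_le_coe_iff.2 huv).trans_lt hω

theorem IsPoissonProcess.measureReal_voidEvent_Ioc (hN : IsPoissonProcess N μ P)
    (hμ : ∀ t : ℝ, IntegrableOn μ (Ioc 0 t))
    (hpos : ∀ᵐ t ∂(volume.restrict (Ioi (0 : ℝ))), 0 < μ t) {a b : ℝ} (hab : a ≤ b) :
    P.real (voidEvent N (Ioc a b)) = Real.exp (-(cumRate μ b - cumRate μ a)) := by
  have h := intensity_Ioc hμ hpos hab
  rw [hN.measureReal_voidEvent measurableSet_Ioc (by rw [h]; exact ENNReal.ofReal_ne_top), h,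
    ENNReal.toReal_ofReal (sub_nonneg.2 (monotone_cumRate hμ hpos hab))]

theorem IsPoissonProcess.tailProb_sub_eq [IsProbabilityMeasure P] (hN : IsPoissonProcess N μ P)
    (hμ : ∀ t : ℝ, IntegrableOn μ (Ioc 0 t))
    (hpos : ∀ᵐ t ∂(volume.restrict (Ioi (0 : ℝ))), 0 < μ t) (ℓ : ℝ) {s t : ℝ} (hst : s ≤ t) :
    tailProb N P ℓ s - tailProb N P ℓ t =
      P.real ({ω | NoGap ℓ (N ω) s} \ {ω | NoGap ℓ (N ω) t}) := by
  rw [hN.tailProb_eq hμ hpos, hN.tailProb_eq hμ hpos, measureReal_sdiff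
    (s₁ := {ω | NoGap ℓ (N ω) s}) (s₂ := {ω | NoGap ℓ (N ω) t})
    (fun ω hω => NoGap.mono hω hst) (hN.measurableSet_noGap ℓ t)]

/-- The probability of no early gap, points in `(s, t]` and no points in `(t, r]`. -/
theorem IsPoissonProcess.measureReal_noGap_inter_Ioc [IsProbabilityMeasure P]
    (hN : IsPoissonProcess N μ P) (hμ : ∀ t : ℝ, IntegrableOn μ (Ioc 0 t))
    (hpos : ∀ᵐ t ∂(volume.restrict (Ioi (0 : ℝ))), 0 < μ t) (ℓ : ℝ) {s t r : ℝ} (hst : s ≤ t)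
    (htr : t ≤ r) :
    P.real ({ω | NoGap ℓ (N ω) (s - ℓ)} ∩
      ({ω | (N ω ∩ Ioc s t).Nonempty} ∩ voidEvent N (Ioc t r))) =
      tailProb N P ℓ (s - ℓ) * ((1 - Real.exp (-(cumRate μ t - cumRate μ s))) *
        Real.exp (-(cumRate μ r - cumRate μ t))) := by
  rw [hN.measureReal_noGap_inter ℓ measurableSet_Ioc measurableSet_Ioc Ioc_subset_Ioi_self
    (fun x hx => hst.trans_lt hx.1) (Ioc_disjoint_Ioc_of_le le_rfl),
    hN.measureReal_voidEvent_Ioc hμ hpos hst, hN.measureReal_voidEvent_Ioc hμ hpos htr,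
    hN.tailProb_eq hμ hpos]

theorem IsPoissonProcess.tailProb_sub_le [IsProbabilityMeasure P] (hN : IsPoissonProcess N μ P)
    (hμ : ∀ t : ℝ, IntegrableOn μ (Ioc 0 t))
    (hpos : ∀ᵐ t ∂(volume.restrict (Ioi (0 : ℝ))), 0 < μ t) {ℓ : ℝ} (hℓ : 0 < ℓ) {s t : ℝ}
    (hs : 0 ≤ s) (hst : s ≤ t) (htℓ : t ≤ s + ℓ) :
    tailProb N P ℓ s - tailProb N P ℓ t ≤
      tailProb N P ℓ (s - ℓ) * ((1 - Real.exp (-(cumRate μ t - cumRate μ s))) *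
        Real.exp (-(cumRate μ (s + ℓ) - cumRate μ t))) := by
  rw [hN.tailProb_sub_eq hμ hpos ℓ hst, ← hN.measureReal_noGap_inter_Ioc hμ hpos ℓ hst htℓ]
  refine measureReal_mono ?_
  rintro ω ⟨hG, hnG⟩
  exact NoGap.of_not_noGap hℓ hs hG hnG

theorem IsPoissonProcess.le_tailProb_sub [IsProbabilityMeasure P] (hN : IsPoissonProcess N μ P)
    (hμ : ∀ t : ℝ, IntegrableOn μ (Ioc 0 t))
    (hpos : ∀ᵐ t ∂(volume.restrict (Ioi (0 : ℝ))), 0 < μ t) {ℓ : ℝ} (hℓ : 0 < ℓ) {s t : ℝ}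
    (hs : 0 ≤ s) (hst : s < t) (htℓ : t ≤ s + ℓ) (h : t < ℓ ∨ ℓ ≤ s) :
    tailProb N P ℓ (s - ℓ) * ((1 - Real.exp (-(cumRate μ t - cumRate μ s))) *
        Real.exp (-(cumRate μ (t + ℓ) - cumRate μ t))) -
      (1 - Real.exp (-(cumRate μ t - cumRate μ s))) * (cumRate μ (t - ℓ) - cumRate μ (s - ℓ)) ≤
      tailProb N P ℓ s - tailProb N P ℓ t := by
  rw [hN.tailProb_sub_eq hμ hpos ℓ hst.le,
    ← hN.measureReal_noGap_inter_Ioc hμ hpos ℓ hst.le (by linarith : t ≤ t + ℓ), sub_le_iff_le_add]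
  have hpoint : ∀ a b : ℝ, {ω | (N ω ∩ Ioc a b).encard ∈ ({0}ᶜ : Set ℕ∞)} =
      (voidEvent N (Ioc a b))ᶜ := fun a b => by
    ext ω
    simp [voidEvent]
  -- The exceptional event has points in two disjoint intervals: one factor is kept exact, the other
  -- is bounded by `1 - exp (-x) ≤ x`.
  have hprod : P.real ((voidEvent N (Ioc s t))ᶜ ∩ (voidEvent N (Ioc (s - ℓ) (t - ℓ)))ᶜ) ≤
      (1 - Real.exp (-(cumRate μ t - cumRate μ s))) *
        (cumRate μ (t - ℓ) - cumRate μ (s - ℓ)) := by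
    have := hN.measure_void_inter_inter MeasurableSet.empty
      (measurableSet_Ioc (a := s) (b := t)) (measurableSet_Ioc (a := s - ℓ) (b := t - ℓ))
      (empty_disjoint _) (empty_disjoint _)
      (Ioc_disjoint_Ioc_of_le (by linarith)).symm {0}ᶜ {0}ᶜ
    rw [hpoint, hpoint] at this
    have hempty : voidEvent N ∅ = univ := by
      ext ω
      simp [voidEvent]
    rw [hempty, univ_inter, measure_univ, one_mul] at this
    rw [measureReal_def, this, ENNReal.toReal_mul, ← measureReal_def, ← measureReal_def,
      probReal_compl_eq_one_sub (hN.measurableSet_voidEvent measurableSet_Ioc),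
      probReal_compl_eq_one_sub (hN.measurableSet_voidEvent measurableSet_Ioc),
      hN.measureReal_voidEvent_Ioc hμ hpos hst.le,
      hN.measureReal_voidEvent_Ioc hμ hpos (by linarith : s - ℓ ≤ t - ℓ)]
    have h1 := Real.add_one_le_exp (-(cumRate μ (t - ℓ) - cumRate μ (s - ℓ)))
    have h2 := monotone_cumRate hμ hpos hst.le
    have h3 : Real.exp (-(cumRate μ t - cumRate μ s)) ≤ 1 := Real.exp_le_one_iff.2 (by linarith)
    exact mul_le_mul_of_nonneg_left (by linarith) (by linarith)
  refine le_trans (le_trans (measureReal_mono ?_) (measureReal_union_le _ _))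
    (add_le_add_right hprod _)
  rintro ω ⟨hG, hne, he⟩
  rcases NoGap.of_nonempty_of_eq_empty hs hst h hG hne he with h' | h'
  · exact Or.inl h'
  · exact Or.inr ⟨hne.ne_empty, h'.ne_empty⟩

end Increments

/-! ### Absolute continuity, derivatives and the integral formula. -/

theorem AbsolutelyContinuousOnInterval.of_dist_le {X Y : Type*} [PseudoMetricSpace X]
    [PseudoMetricSpace Y] {f : ℝ → X} {g : ℝ → Y} {a b : ℝ}
    (hg : AbsolutelyContinuousOnInterval g a b)
    (h : ∀ x ∈ uIcc a b, ∀ y ∈ uIcc a b, dist (f x) (f y) ≤ dist (g x) (g y)) :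
    AbsolutelyContinuousOnInterval f a b := by
  rw [absolutelyContinuousOnInterval_iff] at hg ⊢
  intro ε hε
  obtain ⟨δ, hδ, hgδ⟩ := hg ε hε
  refine ⟨δ, hδ, fun E hE hlt => lt_of_le_of_lt (Finset.sum_le_sum fun i hi => ?_) (hgδ E hE hlt)⟩
  exact h _ (hE.1 i hi).1 _ (hE.1 i hi).2

section Derivative

variable {Ω : Type*} [MeasurableSpace Ω] {P : Measure Ω} {μ : ℝ → ℝ} {N : Ω → Set ℝ}

theorem gapDensity_eq (hμ : ∀ t : ℝ, IntegrableOn μ (Ioc 0 t)) {ℓ : ℝ} (hℓ : 0 < ℓ) {s : ℝ}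
    (hs : 0 ≤ s) : gapDensity N μ P ℓ s =
      Real.exp (-(cumRate μ (s + ℓ) - cumRate μ s)) * tailProb N P ℓ (s - ℓ) * μ s := by
  rw [gapDensity, cumRate_sub_cumRate_of_nonneg hμ hs (by linarith)]

/-- Assuming a right derivative of the cumulative rate, instead of right-continuity of `μ`, covers
both almost every point and the points of right-continuity. -/
theorem IsPoissonProcess.hasDerivWithinAt_tailProb [IsProbabilityMeasure P]
    (hN : IsPoissonProcess N μ P)
    (hμ : ∀ t : ℝ, IntegrableOn μ (Ioc 0 t))
    (hpos : ∀ᵐ t ∂(volume.restrict (Ioi (0 : ℝ))), 0 < μ t) {ℓ : ℝ} (hℓ : 0 < ℓ) {s : ℝ}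
    (hs : 0 ≤ s) (hm : HasDerivWithinAt (cumRate μ) (μ s) (Ici s) s) :
    HasDerivWithinAt (tailProb N P ℓ) (-gapDensity N μ P ℓ s) (Ici s) s := by
  have hcont := continuous_cumRate hμ
  have hc : ∀ f : ℝ → ℝ, Continuous f → Tendsto f (𝓝[>] s) (𝓝 (f s)) := fun f hf =>
    hf.continuousAt.mono_left nhdsWithin_le_nhds
  rw [gapDensity_eq hμ hℓ hs]
  rw [← hasDerivWithinAt_Ioi_iff_Ici] at hm ⊢
  -- `a t` is the probability of a point in `(s, t]`; each bound is its slope at `s` times a factor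
  -- continuous in `t`.
  set a : ℝ → ℝ := fun t => 1 - Real.exp (-(cumRate μ t - cumRate μ s)) with ha
  have ha' : HasDerivWithinAt a (μ s) (Ioi s) s := by
    have := ((hm.sub_const (cumRate μ s)).neg.exp).const_sub (1 : ℝ)
    exact this.congr_deriv (by simp)
  have has : a s = 0 := by simp [ha]
  have hslope := (hasDerivWithinAt_iff_tendsto_slope' self_notMem_Ioi).1 ha'
  rw [hasDerivWithinAt_iff_tendsto_slope' self_notMem_Ioi]
  have hlow : Tendsto (fun t => slope a s t *
      (tailProb N P ℓ (s - ℓ) * Real.exp (-(cumRate μ (t + ℓ) - cumRate μ t)) -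
        (cumRate μ (t - ℓ) - cumRate μ (s - ℓ)))) (𝓝[>] s)
      (𝓝 (Real.exp (-(cumRate μ (s + ℓ) - cumRate μ s)) * tailProb N P ℓ (s - ℓ) * μ s)) := by
    convert hslope.mul (hc (fun t => tailProb N P ℓ (s - ℓ) *
      Real.exp (-(cumRate μ (t + ℓ) - cumRate μ t)) - (cumRate μ (t - ℓ) - cumRate μ (s - ℓ)))
      (by fun_prop)) using 2
    ring
  have hupp : Tendsto (fun t => slope a s t *
      (tailProb N P ℓ (s - ℓ) * Real.exp (-(cumRate μ (s + ℓ) - cumRate μ t)))) (𝓝[>] s)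
      (𝓝 (Real.exp (-(cumRate μ (s + ℓ) - cumRate μ s)) * tailProb N P ℓ (s - ℓ) * μ s)) := by
    convert hslope.mul (hc (fun t => tailProb N P ℓ (s - ℓ) *
      Real.exp (-(cumRate μ (s + ℓ) - cumRate μ t))) (by fun_prop)) using 2
    ring
  have hnear : ∀ᶠ t in 𝓝[>] s, s < t ∧ t ≤ s + ℓ ∧ (t < ℓ ∨ ℓ ≤ s) := by
    have h1 : ∀ᶠ t in 𝓝[>] s, t ≤ s + ℓ := by
      filter_upwards [Ioc_mem_nhdsGT (show s < s + ℓ by linarith)] with t ht using ht.2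
    have h2 : ∀ᶠ t in 𝓝[>] s, t < ℓ ∨ ℓ ≤ s := by
      rcases lt_or_ge s ℓ with h | h
      · filter_upwards [Ioo_mem_nhdsGT h] with t ht using Or.inl ht.2
      · exact Eventually.of_forall fun _ => Or.inr h
    filter_upwards [self_mem_nhdsWithin, h1, h2] with t ht0 ht1 ht2 using ⟨ht0, ht1, ht2⟩
  have hmain : Tendsto (fun t => -slope (tailProb N P ℓ) s t) (𝓝[>] s)
      (𝓝 (Real.exp (-(cumRate μ (s + ℓ) - cumRate μ s)) * tailProb N P ℓ (s - ℓ) * μ s)) := by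
    refine tendsto_of_tendsto_of_tendsto_of_le_of_le' hlow hupp ?_ ?_
    · filter_upwards [hnear] with t ⟨hst, htℓ, h⟩
      have := hN.le_tailProb_sub hμ hpos hℓ hs hst htℓ h
      rw [slope_def_field, slope_def_field, has, sub_zero, ← neg_div, div_mul_eq_mul_div,
        div_le_div_iff_of_pos_right (sub_pos.2 hst)]
      simp only [ha]
      linarith
    · filter_upwards [hnear] with t ⟨hst, htℓ, _⟩
      have := hN.tailProb_sub_le hμ hpos hℓ hs hst.le htℓ
      rw [slope_def_field, slope_def_field, has, sub_zero, ← neg_div, div_mul_eq_mul_div,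
        div_le_div_iff_of_pos_right (sub_pos.2 hst)]
      simp only [ha]
      linarith
  simpa only [neg_neg] using hmain.neg

theorem IsPoissonProcess.tailProb_sub_le_cumRate_sub [IsProbabilityMeasure P]
    (hN : IsPoissonProcess N μ P)
    (hμ : ∀ t : ℝ, IntegrableOn μ (Ioc 0 t))
    (hpos : ∀ᵐ t ∂(volume.restrict (Ioi (0 : ℝ))), 0 < μ t) {ℓ : ℝ} (hℓ : 0 < ℓ) {s t : ℝ}
    (hs : 0 ≤ s) (hst : s ≤ t) :
    tailProb N P ℓ s - tailProb N P ℓ t ≤ cumRate μ t - cumRate μ s := by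
  have hmeas := hN.measureReal_voidEvent_Ioc hμ hpos hst
  rw [hN.tailProb_sub_eq hμ hpos ℓ hst]
  calc P.real ({ω | NoGap ℓ (N ω) s} \ {ω | NoGap ℓ (N ω) t})
      ≤ P.real (voidEvent N (Ioc s t))ᶜ := measureReal_mono fun ω hω =>
        (NoGap.of_not_noGap hℓ hs hω.1 hω.2).2.1.ne_empty
    _ = 1 - Real.exp (-(cumRate μ t - cumRate μ s)) := by
        rw [probReal_compl_eq_one_sub (hN.measurableSet_voidEvent measurableSet_Ioc), hmeas]
    _ ≤ cumRate μ t - cumRate μ s := by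
        linarith [Real.add_one_le_exp (-(cumRate μ t - cumRate μ s))]

theorem IsPoissonProcess.absolutelyContinuousOnInterval_tailProb [IsProbabilityMeasure P]
    (hN : IsPoissonProcess N μ P)
    (hμ : ∀ t : ℝ, IntegrableOn μ (Ioc 0 t))
    (hpos : ∀ᵐ t ∂(volume.restrict (Ioi (0 : ℝ))), 0 < μ t) {ℓ : ℝ} (hℓ : 0 < ℓ) {a b : ℝ}
    (ha : 0 ≤ a) (hb : 0 ≤ b) : AbsolutelyContinuousOnInterval (tailProb N P ℓ) a b := by
  have hm : AbsolutelyContinuousOnInterval (cumRate μ) 0 (max a b) :=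
    (intervalIntegrable_cutRate hμ 0 (max a b)).absolutelyContinuousOnInterval_intervalIntegral
      left_mem_uIcc
  have hsub : uIcc a b ⊆ uIcc 0 (max a b) := by
    rw [uIcc_of_le (le_max_of_le_left ha)]
    exact uIcc_subset_Icc ⟨ha, le_max_left _ _⟩ ⟨hb, le_max_right _ _⟩
  refine (hm.mono hsub).of_dist_le ?_
  have key : ∀ x y, 0 ≤ x → x ≤ y →
      dist (tailProb N P ℓ x) (tailProb N P ℓ y) ≤ dist (cumRate μ x) (cumRate μ y) := by
    intro x y hx hxy
    rw [Real.dist_eq, abs_of_nonneg (sub_nonneg.2 (antitone_tailProb N ℓ hxy)), dist_comm,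
      Real.dist_eq]
    exact (hN.tailProb_sub_le_cumRate_sub hμ hpos hℓ hx hxy).trans (le_abs_self _)
  intro x hx y hy
  have hx0 : 0 ≤ x := (le_min ha hb).trans hx.1
  have hy0 : 0 ≤ y := (le_min ha hb).trans hy.1
  rcases le_total x y with h | h
  · exact key x y hx0 h
  · rw [dist_comm, dist_comm (cumRate μ x)]
    exact key y x hy0 h

theorem IsPoissonProcess.ae_hasDerivAt_tailProb [IsProbabilityMeasure P]
    (hN : IsPoissonProcess N μ P)
    (hμ : ∀ t : ℝ, IntegrableOn μ (Ioc 0 t))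
    (hpos : ∀ᵐ t ∂(volume.restrict (Ioi (0 : ℝ))), 0 < μ t) {ℓ : ℝ} (hℓ : 0 < ℓ) :
    ∀ᵐ t, 0 ≤ t → HasDerivAt (tailProb N P ℓ) (-gapDensity N μ P ℓ t) t := by
  have hd : ∀ᵐ t, DifferentiableAt ℝ (tailProb N P ℓ) t := by
    have := (antitone_tailProb (P := P) N ℓ).neg.ae_differentiableAt
    filter_upwards [this] with t ht
    simpa using ht.neg
  filter_upwards [hd, ae_hasDerivAt_cumRate hμ] with t ht hm ht0
  rw [cutRate_of_nonneg ht0] at hm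
  have h1 := hN.hasDerivWithinAt_tailProb hμ hpos hℓ ht0 hm.hasDerivWithinAt
  have h2 := (uniqueDiffWithinAt_Ici t).eq_deriv _ h1 ht.hasDerivAt.hasDerivWithinAt
  rw [h2]
  exact ht.hasDerivAt

/-- The density is a.e. minus the derivative of an absolutely continuous function, which yields
measurability, integrability and the value at once. -/
theorem IsPoissonProcess.intervalIntegrable_gapDensity [IsProbabilityMeasure P]
    (hN : IsPoissonProcess N μ P)
    (hμ : ∀ t : ℝ, IntegrableOn μ (Ioc 0 t))
    (hpos : ∀ᵐ t ∂(volume.restrict (Ioi (0 : ℝ))), 0 < μ t) {ℓ : ℝ} (hℓ : 0 < ℓ) {a b : ℝ}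
    (ha : 0 ≤ a) (hb : 0 ≤ b) :
    IntervalIntegrable (gapDensity N μ P ℓ) volume a b ∧
      ∫ s in a..b, gapDensity N μ P ℓ s = tailProb N P ℓ a - tailProb N P ℓ b := by
  have hac := hN.absolutelyContinuousOnInterval_tailProb hμ hpos hℓ ha hb
  have hae : ∀ᵐ t, t ∈ uIoc a b → -deriv (tailProb N P ℓ) t = gapDensity N μ P ℓ t := by
    filter_upwards [hN.ae_hasDerivAt_tailProb hμ hpos hℓ] with t ht htab
    rw [(ht ((le_min ha hb).trans htab.1.le)).deriv, neg_neg]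
  constructor
  · exact hac.intervalIntegrable_deriv.neg.congr_ae
      ((ae_restrict_iff' measurableSet_uIoc).2 hae)
  · rw [← intervalIntegral.integral_congr_ae hae, intervalIntegral.integral_neg,
      hac.integral_deriv_eq_sub, neg_sub]

theorem gapDensity_nonneg_ae (hpos : ∀ᵐ t ∂(volume.restrict (Ioi (0 : ℝ))), 0 < μ t) (ℓ : ℝ) :
    ∀ᵐ t, 0 < t → 0 ≤ gapDensity N μ P ℓ t := by
  filter_upwards [(ae_restrict_iff' measurableSet_Ioi).1 hpos] with t ht ht0
  exact mul_nonneg (mul_nonneg (Real.exp_pos _).le (tailProb_nonneg N P _ _)) (ht ht0).le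

/-- The density is a.e. nonnegative and its integrals over bounded intervals are differences of
probabilities, hence at most `1`. -/
theorem IsPoissonProcess.integrableOn_gapDensity [IsProbabilityMeasure P]
    (hN : IsPoissonProcess N μ P)
    (hμ : ∀ t : ℝ, IntegrableOn μ (Ioc 0 t))
    (hpos : ∀ᵐ t ∂(volume.restrict (Ioi (0 : ℝ))), 0 < μ t) {ℓ : ℝ} (hℓ : 0 < ℓ) {t : ℝ}
    (ht : 0 ≤ t) : IntegrableOn (gapDensity N μ P ℓ) (Ioi t) := by
  have hmax : ∀ n : ℕ, t ≤ max t n := fun n => le_max_left _ _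
  refine integrableOn_Ioi_of_intervalIntegral_norm_bounded (l := atTop)
    (b := fun n : ℕ => max t n) 1 t (fun n => ?_) ?_ (Eventually.of_forall fun n => ?_)
  · exact (intervalIntegrable_iff_integrableOn_Ioc_of_le (hmax n)).1
      (hN.intervalIntegrable_gapDensity hμ hpos hℓ ht (ht.trans (hmax n))).1
  · exact tendsto_atTop_mono (fun n => le_max_right t (n : ℝ)) tendsto_natCast_atTop_atTop
  · have h := (hN.intervalIntegrable_gapDensity hμ hpos hℓ ht (ht.trans (hmax n))).2
    rw [intervalIntegral.integral_congr_ae (g := gapDensity N μ P ℓ), h]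
    · linarith [tailProb_le_one (P := P) N ℓ t, tailProb_nonneg N P ℓ (max t n)]
    · filter_upwards [gapDensity_nonneg_ae (N := N) (P := P) hpos ℓ] with s hs hsI
      rw [uIoc_of_le (hmax n)] at hsI
      exact Real.norm_of_nonneg (hs (ht.trans_lt hsI.1))

theorem IsPoissonProcess.measureReal_firstGap_mem_Ioo_top [IsProbabilityMeasure P]
    (hN : IsPoissonProcess N μ P)
    (hμ : ∀ t : ℝ, IntegrableOn μ (Ioc 0 t))
    (hpos : ∀ᵐ t ∂(volume.restrict (Ioi (0 : ℝ))), 0 < μ t) {ℓ : ℝ} (hℓ : 0 < ℓ) {t : ℝ}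
    (ht : 0 ≤ t) :
    P.real {ω | (t : EReal) < firstGap ℓ (N ω) ∧ firstGap ℓ (N ω) < ⊤} =
      ∫ s in Ioi t, gapDensity N μ P ℓ s := by
  have hmax : ∀ n : ℕ, t ≤ max t n := fun n => le_max_left _ _
  have hlim : Tendsto (fun n : ℕ => max t n) atTop atTop :=
    tendsto_atTop_mono (fun n => le_max_right t (n : ℝ)) tendsto_natCast_atTop_atTop
  refine tendsto_nhds_unique ?_ (intervalIntegral_tendsto_integral_Ioi t
    (hN.integrableOn_gapDensity hμ hpos hℓ ht) hlim)
  have hset : {ω | (t : EReal) < firstGap ℓ (N ω) ∧ firstGap ℓ (N ω) < ⊤} =ᵐ[P]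
      ⋃ n : ℕ, {ω | NoGap ℓ (N ω) t} \ {ω | NoGap ℓ (N ω) (max t n)} := by
    filter_upwards [hN.ae_lt_firstGap_iff hμ hpos ℓ] with ω hω
    refine propext ?_
    change ((t : EReal) < firstGap ℓ (N ω) ∧ firstGap ℓ (N ω) < ⊤) ↔
      ω ∈ ⋃ n : ℕ, {ω | NoGap ℓ (N ω) t} \ {ω | NoGap ℓ (N ω) (max t n)}
    simp only [mem_iUnion, Set.mem_sdiff, mem_ofPred_eq, exists_and_left, ← hω, not_lt]
    refine and_congr_right fun _ => ⟨fun h => ?_, fun ⟨n, hn⟩ => hn.trans_lt (EReal.coe_lt_top _)⟩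
    obtain ⟨q, hq, -⟩ := EReal.exists_rat_btwn_of_lt h
    obtain ⟨n, hn⟩ := exists_nat_ge (q : ℝ)
    exact ⟨n, hq.le.trans (EReal.coe_le_coe_iff.2 (hn.trans (le_max_right _ _)))⟩
  have hmono : Monotone fun n : ℕ =>
      {ω | NoGap ℓ (N ω) t} \ {ω | NoGap ℓ (N ω) (max t n)} := fun m n hmn =>
    sdiff_subset_sdiff_right fun ω hω =>
      NoGap.mono hω (max_le_max le_rfl (Nat.cast_le.2 hmn))
  rw [measureReal_congr hset]
  refine ((ENNReal.tendsto_toReal (measure_ne_top P _)).comp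
    (tendsto_measure_iUnion_atTop hmono)).congr fun n => ?_
  rw [(hN.intervalIntegrable_gapDensity hμ hpos hℓ ht (ht.trans (hmax n))).2,
    hN.tailProb_sub_eq hμ hpos ℓ (hmax n)]
  rfl

theorem IsPoissonProcess.aemeasurable_firstGap (hN : IsPoissonProcess N μ P)
    (hμ : ∀ t : ℝ, IntegrableOn μ (Ioc 0 t))
    (hpos : ∀ᵐ t ∂(volume.restrict (Ioi (0 : ℝ))), 0 < μ t) (ℓ : ℝ) :
    AEMeasurable (fun ω => firstGap ℓ (N ω)) P := by
  classical
  -- The measurable version is the supremum of the rationals below `D`, with `q < D` replaced by the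
  -- no-gap event, to which it is a.s. equivalent.
  refine ⟨fun ω => ⨆ q : ℚ, if NoGap ℓ (N ω) q then ((q : ℝ) : EReal) else ⊥, ?_, ?_⟩
  · exact Measurable.iSup fun q =>
      Measurable.ite (hN.measurableSet_noGap ℓ q) measurable_const measurable_const
  · filter_upwards [hN.ae_lt_firstGap_iff hμ hpos ℓ] with ω hω
    simp only [← hω]
    refine le_antisymm (le_of_forall_lt fun c hc => ?_) (iSup_le fun q => ?_)
    · obtain ⟨q, hcq, hq⟩ := EReal.exists_rat_btwn_of_lt hc
      refine hcq.trans_le (le_iSup_of_le q ?_)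
      rw [if_pos hq]
    · split_ifs with h
      · exact h.le
      · exact bot_le

theorem IsPoissonProcess.continuousAt_tailProb [IsProbabilityMeasure P]
    (hN : IsPoissonProcess N μ P)
    (hμ : ∀ t : ℝ, IntegrableOn μ (Ioc 0 t))
    (hpos : ∀ᵐ t ∂(volume.restrict (Ioi (0 : ℝ))), 0 < μ t) {ℓ : ℝ} (hℓ : 0 < ℓ) {u : ℝ}
    (hu : u ≠ 0) : ContinuousAt (tailProb N P ℓ) u := by
  rcases lt_or_gt_of_ne hu with hu | hu
  · refine (continuousAt_const (y := (1 : ℝ))).congr ?_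
    filter_upwards [Iio_mem_nhds hu] with v hv
    exact (hN.tailProb_of_neg hμ hpos ℓ hv).symm
  · have h := (hN.absolutelyContinuousOnInterval_tailProb hμ hpos hℓ le_rfl
      (by linarith : 0 ≤ u + 1)).continuousOn
    rw [uIcc_of_le (by linarith)] at h
    exact h.continuousAt (Icc_mem_nhds hu (by linarith))

theorem IsPoissonProcess.hasDerivAt_tailProb [IsProbabilityMeasure P]
    (hN : IsPoissonProcess N μ P)
    (hμ : ∀ t : ℝ, IntegrableOn μ (Ioc 0 t))
    (hpos : ∀ᵐ t ∂(volume.restrict (Ioi (0 : ℝ))), 0 < μ t) {ℓ : ℝ} (hℓ : 0 < ℓ) {t : ℝ}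
    (ht : 0 < t) (htℓ : t ≠ ℓ) (hc : ContinuousAt μ t) :
    HasDerivAt (tailProb N P ℓ) (-gapDensity N μ P ℓ t) t := by
  have hcont := continuous_cumRate hμ
  have hg : ContinuousAt (gapDensity N μ P ℓ) t := by
    -- `P(D > ·)` may jump at `0`, since `D = 0` is possible; hence `t ≠ ℓ`.
    have h1 : ContinuousAt (fun s => tailProb N P ℓ (s - ℓ)) t :=
      ContinuousAt.comp (f := fun s => s - ℓ)
        (hN.continuousAt_tailProb hμ hpos hℓ (sub_ne_zero.2 htℓ)) (by fun_prop)
    have h2 : ContinuousAt (fun s => Real.exp (-(cumRate μ (s + ℓ) - cumRate μ s))) t :=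
      Continuous.continuousAt (by fun_prop)
    refine ((h2.mul h1).mul hc).congr ?_
    filter_upwards [Ioi_mem_nhds ht] with s hs
    exact (gapDensity_eq hμ hℓ (le_of_lt hs)).symm
  have hint : ∀ s : ℝ, 0 ≤ s → _ := fun s hs =>
    hN.intervalIntegrable_gapDensity hμ hpos hℓ (le_refl 0) hs
  have hd : HasDerivAt (fun s => ∫ x in (0 : ℝ)..s, gapDensity N μ P ℓ x)
      (gapDensity N μ P ℓ t) t := by
    refine intervalIntegral.integral_hasDerivAt_right (hint t ht.le).1
      ⟨Ioc 0 (t + 1), Ioc_mem_nhds ht (by linarith), ?_⟩ hg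
    exact ((intervalIntegrable_iff_integrableOn_Ioc_of_le (by linarith)).1
      (hint (t + 1) (by linarith)).1).aestronglyMeasurable
  refine (hd.const_sub (tailProb N P ℓ 0)).congr_of_eventuallyEq ?_
  filter_upwards [Ioi_mem_nhds ht] with s hs
  rw [(hint s (le_of_lt hs)).2, sub_sub_cancel]

end Derivative

theorem mainTheorem8 {Ω : Type*} [MeasurableSpace Ω] (P : Measure Ω) [IsProbabilityMeasure P]
    (μ : ℝ → ℝ) (hμ_int : ∀ t : ℝ, IntegrableOn μ (Ioc 0 t))
    (hμ_pos : ∀ᵐ t ∂(volume.restrict (Ioi (0 : ℝ))), 0 < μ t)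
    (N : Ω → Set ℝ) (hN : IsPoissonProcess N μ P) (ℓ : ℝ) (hℓ : 0 < ℓ) :
    -- `D` is a random variable
    AEMeasurable (fun ω => firstGap ℓ (N ω)) P ∧
    -- the formula for `P(D ∈ (t, ∞))`
    (∀ t : ℝ, 0 ≤ t →
      IntegrableOn (gapDensity N μ P ℓ) (Ioi t) ∧
      P.real {ω | (t : EReal) < firstGap ℓ (N ω) ∧ firstGap ℓ (N ω) < ⊤} =
        ∫ s in Ioi t, gapDensity N μ P ℓ s) ∧
    -- the delay differential equation: `t ↦ P(D > t)` is locally absolutely continuous on `[0, ∞)`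
    -- and satisfies the equation for almost every `t ≥ 0`,
    (∀ b : ℝ, 0 ≤ b → AbsolutelyContinuousOnInterval (tailProb N P ℓ) 0 b) ∧
    (∀ᵐ t ∂(volume.restrict (Ici (0 : ℝ))),
      HasDerivAt (tailProb N P ℓ) (-gapDensity N μ P ℓ t) t) ∧
    -- for the right derivative at every `t ≥ 0` at which `μ` is right-continuous,
    (∀ t : ℝ, 0 ≤ t → ContinuousWithinAt μ (Ici t) t →
      HasDerivWithinAt (tailProb N P ℓ) (-gapDensity N μ P ℓ t) (Ici t) t) ∧
    -- and for the derivative at every `t > 0`, `t ≠ ℓ`, at which `μ` is continuous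
    (∀ t : ℝ, 0 < t → t ≠ ℓ → ContinuousAt μ t →
      HasDerivAt (tailProb N P ℓ) (-gapDensity N μ P ℓ t) t) := by
  refine ⟨hN.aemeasurable_firstGap hμ_int hμ_pos ℓ, fun t ht => ⟨?_, ?_⟩, fun b hb => ?_, ?_,
    fun t ht hc => ?_, fun t ht htℓ hc => ?_⟩
  · exact hN.integrableOn_gapDensity hμ_int hμ_pos hℓ ht
  · exact hN.measureReal_firstGap_mem_Ioo_top hμ_int hμ_pos hℓ ht
  · exact hN.absolutelyContinuousOnInterval_tailProb hμ_int hμ_pos hℓ le_rfl hb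
  · exact (ae_restrict_iff' measurableSet_Ici).2 (hN.ae_hasDerivAt_tailProb hμ_int hμ_pos hℓ)
  · exact hN.hasDerivWithinAt_tailProb hμ_int hμ_pos hℓ ht (hasDerivWithinAt_cumRate hμ_int ht hc)
  · exact hN.hasDerivAt_tailProb hμ_int hμ_pos hℓ ht htℓ hc
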